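/- Let $\varphi_0,\varphi_1,\ldots$ be a standard enumeration of the computable partial functions $\mathbb{N}\rightharpoonup\mathbb{N}$, let $\mathcal{W}_e=\operatorname{dom}\varphi_e$ be the $e$-th recursively enumerable set, and let $\mathcal{K}=\{e : \varphi_e(e)\text{ is defined}\}$. Write $A(z)\in\{0,1\}$ for the value at $z$ of the characteristic function of $A\subseteq\mathbb{N}$, and write $A\leq_{\mathrm T}B$ if this function is computable with oracle $B$, and $A<_{\mathrm T}B$ if $A\leq_{\mathrm T}B$ and $B\not\leq_{\mathrm T}A$. For $f\colon\mathbb{N}\to\mathbb{N}$, a recursively enumerable set $A\subseteq\mathbb{N}$ is called $f$-$\mathcal{W}$-w.e.u. if there is a computable $g\colon\mathbb{N}\to\mathbb{N}$ such that for all $e\in\mathbb{N}$: 1. $|\mathcal{W}_{g(e)}|\leq f(e)$, and 2. if $\varphi_e(z)$ is defined for every $z\in\mathcal{W}_{g(e)}$, then $\varphi_e(z)\neq A(z)$ for some $z\in\mathcal{W}_{g(e)}$. **Proposition.** Let $f\colon\mathbb{N}\to\mathbb{N}$ be a computable function that is order-preserving ($m\leq n$ implies $f(m)\leq f(n)$)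 and such that for every $N\in\mathbb{N}$ there is an $M\in\mathbb{N}$ with $$f(N+M)\geq (N+M+1)\,(f(N)+1).$$ Then there is a recursively enumerable set $A\subseteq\mathbb{N}$ with $\emptyset<_{\mathrm T}A<_{\mathrm T}\mathcal{K}$ that is $\max(f,1)$-$\mathcal{W}$-w.e.u.; in particular, if $f(0)\geq 1$, then $A$ is $f$-$\mathcal{W}$-w.e.u. **Corollary.** There is an $n^2$-$\mathcal{W}$-w.e.u. solution to Post's problem, where the bound $0$ at $n=0$ is read as $1$: there is a recursively enumerable set $A\subseteq\mathbb{N}$ with $\emptyset<_{\mathrm T}A<_{\mathrm T}\mathcal{K}$ that is $\max(n^2,1)$-$\mathcal{W}$-w.e.u. -/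

import Mathlib

namespace PostProblem

/-- `φ e` is the `e`-th computable partial function `ℕ ⇀ ℕ`, in Mathlib's standard enumeration of
programs. -/
def φ (e : ℕ) : ℕ →. ℕ :=
  (Denumerable.ofNat Nat.Partrec.Code e).eval

/-- `W e` is the `e`-th recursively enumerable set, the domain of `φ e`. -/
def W (e : ℕ) : Set ℕ :=
  {n | (φ e n).Dom}

/-- The halting set `K = {e | φ e e ↓}`. -/
def K : Set ℕ :=
  {e | (φ e e).Dom}

/-- The characteristic function of a set of natural numbers, with values `0` and `1`. -/
noncomputable def chi (A : Set ℕ) : ℕ → ℕ :=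
  A.indicator 1

/-- Turing reducibility between sets: the characteristic function of `A` is partial recursive with
the characteristic function of `B` as an oracle. -/
def TuringLE (A B : Set ℕ) : Prop :=
  TuringReducible (fun n => Part.some (chi A n)) (fun n => Part.some (chi B n))

/-- Strict Turing reducibility, `A <_T B`. -/
def TuringLT (A B : Set ℕ) : Prop :=
  TuringLE A B ∧ ¬ TuringLE B A

/-- `A` is `f`-`W`-w.e.u.: `A` is recursively enumerable, and from a program `e` one computes an
index of a recursively enumerable set with at most `f e` elements, such that `φ e`, if it is
defined on that whole set, differs from the characteristic function of `A` somewhere on it. -/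
def IsWWEU (f : ℕ → ℕ) (A : Set ℕ) : Prop :=
  REPred (fun n => n ∈ A) ∧
  ∃ g : ℕ → ℕ, Computable g ∧ ∀ e : ℕ,
    (W (g e)).encard ≤ (f e : ℕ∞) ∧
    ((∀ z ∈ W (g e), (φ e z).Dom) → ∃ z ∈ W (g e), φ e z ≠ Part.some (chi A z))

end PostProblem

namespace PostProblem

open Filter Encodable Denumerable
open Nat.Partrec (Code)

/-! A finite-injury priority construction builds two r.e. sets, A = `enumerated c 1` and B =
`enumerated c 0`. Requirement `2 * e + 1` puts its witness z into A once φ_e(z) = 0 is seen. A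
negative requirement `2 * i` puts its witness into B once its functional gives 0 there with oracle
A, and the new witnesses forced on lower odd requirements preserve that computation. So B is not
computable from A; since B is r.e., B ≤ K, hence K is not computable from A.

W_{g(e)} is the set of all witnesses `2 * e + 1` ever has: one, plus one per injury. Odd
requirements act at most once, so `2 * i` is injured at most i times and acts at most i + 1 times.
The e-th witness set thus has at most 1 + Σ (i + 1) elements, summed over the negative requirements
placed at i ≤ e. Placing them sparsely keeps this below max(f(e), 1), and the growth of f leaves
room for all of them. -/

/-! ### The use principle for oracle computations. -/

/-- Every function computable from a total oracle `g` is the limit of a partial recursive functional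
evaluated at the finite initial segments of `g`. -/
theorem exists_partrec_functional {g : ℕ → ℕ} {h : ℕ →. ℕ}
    (hh : TuringReducible h (fun n => Part.some (g n))) :
    ∃ F : List ℕ → ℕ →. ℕ, Partrec₂ F ∧
      (∀ n x, ∀ y ∈ F ((List.range n).map g) x, y ∈ h x) ∧
      (∀ x, ∀ y ∈ h x, ∀ᶠ n in atTop, y ∈ F ((List.range n).map g) x) := by
  replace hh := RecursiveIn.iff_nat.1 hh
  have of_partrec : ∀ {p : ℕ →. ℕ}, Nat.Partrec p → ∃ F : List ℕ → ℕ →. ℕ, Partrec₂ F ∧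
      (∀ n x, ∀ y ∈ F ((List.range n).map g) x, y ∈ p x) ∧
      (∀ x, ∀ y ∈ p x, ∀ᶠ n in atTop, y ∈ F ((List.range n).map g) x) := fun {p} hp =>
    ⟨fun _ => p, ((Partrec.nat_iff.2 hp).comp Computable.snd).to₂,
      fun _ _ _ h => h, fun _ _ h => Eventually.of_forall fun _ => h⟩
  induction hh with
  | zero => exact of_partrec .zero
  | succ => exact of_partrec .succ
  | left => exact of_partrec .left
  | right => exact of_partrec .right
  | oracle q hq =>
    obtain rfl := hq
    -- A query beyond the known segment diverges, so no wrong answer is ever given.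
    refine ⟨fun σ x => (σ[x]? : Option ℕ), Computable.ofOption Computable.list_getElem?, ?_, ?_⟩
    · intro n x y hy
      simp only [Part.mem_ofOption, Option.mem_def, List.getElem?_map, Option.map_eq_some_iff,
        List.getElem?_eq_some_iff, List.getElem_range] at hy
      obtain ⟨_, ⟨_, rfl⟩, rfl⟩ := hy
      exact Part.mem_some _
    · intro x y hy
      obtain rfl := Part.mem_some_iff.1 hy
      filter_upwards [eventually_gt_atTop x] with n hn
      simp [hn]
  | @pair p q _ _ ihp ihq =>
    obtain ⟨F, hF, hF₁, hF₂⟩ := ihp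
    obtain ⟨G, hG, hG₁, hG₂⟩ := ihq
    have mem_pair : ∀ (u v : Part ℕ) (y : ℕ), y ∈ Nat.pair <$> u <*> v ↔
        ∃ a ∈ u, ∃ b ∈ v, Nat.pair a b = y := fun u v y => by simp [Seq.seq]
    refine ⟨fun σ x => Nat.pair <$> F σ x <*> G σ x, ?_, ?_, ?_⟩
    · refine (Partrec.bind (f := fun z : List ℕ × ℕ => F z.1 z.2)
        (g := fun z a => (G z.1 z.2).map fun b => Nat.pair a b) hF (Partrec.map ?_ ?_)).of_eq
        fun z => by simp [Seq.seq]
      · exact hG.comp (Computable.fst.comp Computable.fst) (Computable.snd.comp Computable.fst)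
      · exact (Primrec₂.natPair.to_comp.comp (Computable.snd.comp Computable.fst)
          Computable.snd).to₂
    · intro n x y hy
      obtain ⟨a, ha, b, hb, rfl⟩ := (mem_pair _ _ _).1 hy
      exact (mem_pair _ _ _).2 ⟨a, hF₁ _ _ _ ha, b, hG₁ _ _ _ hb, rfl⟩
    · intro x y hy
      obtain ⟨a, ha, b, hb, rfl⟩ := (mem_pair _ _ _).1 hy
      filter_upwards [hF₂ _ _ ha, hG₂ _ _ hb] with n h₁ h₂
      exact (mem_pair _ _ _).2 ⟨a, h₁, b, h₂, rfl⟩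
  | @comp p q _ _ ihp ihq =>
    obtain ⟨F, hF, hF₁, hF₂⟩ := ihp
    obtain ⟨G, hG, hG₁, hG₂⟩ := ihq
    refine ⟨fun σ x => (G σ x).bind (F σ), ?_, ?_, ?_⟩
    · exact Partrec.bind hG (hF.comp (Computable.fst.comp Computable.fst) Computable.snd)
    · intro n x y hy
      obtain ⟨a, ha, hy⟩ := Part.mem_bind_iff.1 hy
      exact Part.mem_bind_iff.2 ⟨a, hG₁ _ _ _ ha, hF₁ _ _ _ hy⟩
    · intro x y hy
      obtain ⟨a, ha, hy⟩ := Part.mem_bind_iff.1 hy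
      filter_upwards [hG₂ _ _ ha, hF₂ _ _ hy] with n h₁ h₂ using Part.mem_bind_iff.2 ⟨a, h₁, h₂⟩
  | @prec p q _ _ ihp ihq =>
    obtain ⟨F, hF, hF₁, hF₂⟩ := ihp
    obtain ⟨G, hG, hG₁, hG₂⟩ := ihq
    refine ⟨fun σ x => x.unpair.2.rec (F σ x.unpair.1) fun k IH => IH.bind fun i =>
      G σ (Nat.pair x.unpair.1 (Nat.pair k i)), ?_, ?_, ?_⟩
    · refine Partrec.nat_rec (f := fun z : List ℕ × ℕ => z.2.unpair.2)
        (h := fun z ki => G z.1 (Nat.pair z.2.unpair.1 (Nat.pair ki.1 ki.2))) (Computable.snd.comp (Computable.unpair.comp Computable.snd))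
        (hF.comp Computable.fst (Computable.fst.comp (Computable.unpair.comp Computable.snd)))
        (hG.comp (Computable.fst.comp Computable.fst) ?_)
      exact Primrec₂.natPair.to_comp.comp
        (Computable.fst.comp (Computable.unpair.comp (Computable.snd.comp Computable.fst)))
        (Primrec₂.natPair.to_comp.comp (Computable.fst.comp Computable.snd)
          (Computable.snd.comp Computable.snd))
    · intro n x
      dsimp only
      induction x.unpair.2 with
      | zero => exact hF₁ _ _
      | succ k ih =>
        intro y hy
        obtain ⟨i, hi, hy⟩ := Part.mem_bind_iff.1 hy
        exact Part.mem_bind_iff.2 ⟨i, ih _ hi, hG₁ _ _ _ hy⟩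
    · intro x
      dsimp only
      induction x.unpair.2 with
      | zero => exact hF₂ _
      | succ k ih =>
        intro y hy
        obtain ⟨i, hi, hy⟩ := Part.mem_bind_iff.1 hy
        filter_upwards [ih _ hi, hG₂ _ _ hy] with n h₁ h₂ using Part.mem_bind_iff.2 ⟨i, h₁, h₂⟩
  | @rfind p _ ihp =>
    obtain ⟨F, hF, hF₁, hF₂⟩ := ihp
    refine ⟨fun σ x => Nat.rfind fun k => (F σ (Nat.pair x k)).map fun m => decide (m = 0),
      ?_, ?_, ?_⟩
    · refine Partrec.rfind (p := fun (a : List ℕ × ℕ) k =>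
        (F a.1 (Nat.pair a.2 k)).map fun m => decide (m = 0)) (Partrec.map ?_ ?_)
      · exact hF.comp (Computable.fst.comp Computable.fst)
          (Primrec₂.natPair.to_comp.comp (Computable.snd.comp Computable.fst) Computable.snd)
      · exact ((PrimrecRel.decide Primrec.eq).comp Primrec.snd (Primrec.const 0)).to_comp.to₂
    · intro n x y hy
      obtain ⟨h₀, H⟩ := Nat.mem_rfind.1 hy
      obtain ⟨a, ha, ha'⟩ := (Part.mem_map_iff _).1 h₀
      refine Nat.mem_rfind.2 ⟨(Part.mem_map_iff _).2 ⟨a, hF₁ _ _ _ ha, ha'⟩, fun hm => ?_⟩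
      obtain ⟨b, hb, hb'⟩ := (Part.mem_map_iff _).1 (H hm)
      exact (Part.mem_map_iff _).2 ⟨b, hF₁ _ _ _ hb, hb'⟩
    · intro x y hy
      obtain ⟨h₀, H⟩ := Nat.mem_rfind.1 hy
      obtain ⟨a, ha, ha'⟩ := (Part.mem_map_iff _).1 h₀
      -- The search makes only finitely many tests, so one long segment serves them all.
      have H' : ∀ᶠ n in atTop, ∀ m ∈ Set.Iio y, ∃ b ∈ F ((List.range n).map g) (Nat.pair x m),
          decide (b = 0) = false := by
        refine (Set.finite_Iio y).eventually_all.2 fun m hm => ?_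
        obtain ⟨b, hb, hb'⟩ := (Part.mem_map_iff _).1 (H hm)
        filter_upwards [hF₂ _ _ hb] with n hn using ⟨b, hn, hb'⟩
      filter_upwards [hF₂ _ _ ha, H'] with n h₁ h₂
      exact Nat.mem_rfind.2 ⟨(Part.mem_map_iff _).2 ⟨a, h₁, ha'⟩,
        fun hm => (Part.mem_map_iff _).2 (h₂ _ hm)⟩

/-! ### Indices, completeness of K, and noncomputability. -/

theorem phi_encode (c : Nat.Partrec.Code) : φ (Encodable.encode c) = c.eval := by
  simp [φ]

/-- The s-m-n theorem for the enumeration `φ`. -/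
theorem exists_computable_phi {f : ℕ → ℕ →. ℕ} (hf : Partrec₂ f) :
    ∃ g : ℕ → ℕ, Computable g ∧ ∀ n, φ (g n) = f n := by
  obtain ⟨c, hc⟩ := Nat.Partrec.Code.exists_code.1 (Partrec₂.unpaired'.2 hf)
  refine ⟨fun n => Encodable.encode (c.curry n), ?_, fun n => ?_⟩
  · exact Computable.encode.comp
      (Nat.Partrec.Code.primrec₂_curry.to_comp.comp (Computable.const c) Computable.id)
  · funext x
    rw [phi_encode, Nat.Partrec.Code.eval_curry, hc]
    simp

theorem turingLE_of_many_one {A B : Set ℕ} {h : ℕ → ℕ} (hh : Computable h)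
    (hAB : ∀ n, n ∈ A ↔ h n ∈ B) : TuringLE A B := by
  refine RecursiveIn.iff_nat.2 <| (Nat.RecursiveIn.comp (.oracle _ (Set.mem_singleton _))
    (Nat.Partrec.recursiveIn (Partrec.nat_iff.1 hh.partrec))).of_eq fun n => ?_
  by_cases hn : n ∈ A
  · simp [chi, hn, (hAB n).1 hn]
  · simp [chi, hn, (hAB n).not.1 hn]

/-- The halting set is complete among the recursively enumerable sets. -/
theorem turingLE_K {A : Set ℕ} (hA : REPred (fun n => n ∈ A)) : TuringLE A K := by
  have hA' : Partrec₂ fun n (_ : ℕ) => (Part.assert (n ∈ A) fun _ => Part.some ()).map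
      fun _ => (0 : ℕ) :=
    Partrec.map (hA.comp Computable.fst) (Computable.const 0).to₂
  obtain ⟨g, hg, hgf⟩ := exists_computable_phi hA'
  refine turingLE_of_many_one hg fun n => ?_
  simp [K, hgf, Part.assert]

theorem computable_chi_of_turingLE_empty {A : Set ℕ} (hA : TuringLE A ∅) :
    Computable (chi A) := by
  refine RecursiveIn.partrec_of_oracle (O := {fun n => Part.some (chi ∅ n)}) ?_ hA
  rintro _ rfl
  simpa [chi] using Partrec.const' (Part.some 0)

theorem rePred_exists {α : Type*} [Primcodable α] {p : α → ℕ → Prop} [∀ a n, Decidable (p a n)]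
    (hp : Computable₂ fun a n => decide (p a n)) : REPred fun a => ∃ n, p a n := by
  refine (Partrec.dom_re (f := fun a => Nat.rfind fun n => Part.some (decide (p a n)))
    (Partrec.rfind hp.partrec₂)).of_eq fun a => ?_
  refine Nat.rfind_dom.trans ?_
  simp

/-- An index of the characteristic function would be total and never err. -/
theorem IsWWEU.not_computable_chi {f : ℕ → ℕ} {A : Set ℕ} (hA : IsWWEU f A) :
    ¬ Computable (chi A) := by
  intro h
  obtain ⟨c, hc⟩ := Nat.Partrec.Code.exists_code.1 (Partrec.nat_iff.1 h.partrec)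
  obtain ⟨_, g, _, hg⟩ := hA
  obtain ⟨z, _, hz⟩ := (hg (Encodable.encode c)).2 fun z _ => by simp [phi_encode, hc]
  simp [phi_encode, hc] at hz

theorem IsWWEU.empty_turingLT {f : ℕ → ℕ} {A : Set ℕ} (hA : IsWWEU f A) : TuringLT ∅ A := by
  refine ⟨?_, fun h => hA.not_computable_chi (computable_chi_of_turingLE_empty h)⟩
  have : Partrec fun _ : ℕ => Part.some 0 := Partrec.const' _
  simpa [TuringLE, chi] using! this.turingReducible

theorem computable_of_succ {α : Type*} [Primcodable α] {u : ℕ → α} {step : ℕ × α → α}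
    (hstep : Computable step) (hu : ∀ n, u (n + 1) = step (n, u n)) : Computable u := by
  refine (Computable.nat_rec Computable.id (Computable.const (u 0))
    (hstep.comp Computable.snd).to₂).of_eq fun n => ?_
  induction n with
  | zero => rfl
  | succ n ih => exact (congrArg (fun a => step (n, a)) ih).trans (hu n).symm

/-! ### Spacing the negative requirements under the bound. -/

/-- Given the bound `f`, `budget f e` records how many negative requirements are placed below `e`,
and how many candidates the positive requirement of `e` may need. A new negative requirement is
placed at `e` as soon as `f e` leaves room for its at most `e + 1` actions. -/
def budget (f : ℕ → ℕ) : ℕ → ℕ × ℕ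
  | 0 => (0, 1)
  | e + 1 => if (budget f e).2 + e + 1 ≤ f e then ((budget f e).1 + 1, (budget f e).2 + e + 1)
      else budget f e

/-- `placement f e` is `k + 1` if the `k`-th negative requirement is placed at `e`, and `0` if none
is placed there. -/
def placement (f : ℕ → ℕ) (e : ℕ) : ℕ :=
  if (budget f e).2 + e + 1 ≤ f e then (budget f e).1 + 1 else 0

theorem sum_placement (f : ℕ → ℕ) (e : ℕ) :
    1 + ∑ i ∈ Finset.range e, (if placement f i = 0 then 0 else i + 1) = (budget f e).2 := by
  induction e with
  | zero => rfl
  | succ e ih =>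
    rw [Finset.sum_range_succ, ← add_assoc, ih, budget, placement]
    split_ifs <;> simp_all [add_assoc]

/-- The count grows only when f(e) permits, and monotonicity preserves the bound afterwards. The
initial witness accounts for the 1 in the maximum. -/
theorem budget_le {f : ℕ → ℕ} (hf : Monotone f) (e : ℕ) : (budget f (e + 1)).2 ≤ max (f e) 1 := by
  induction e with
  | zero =>
    rw [budget, show budget f 0 = (0, 1) from rfl]
    split_ifs with h
    · exact le_max_of_le_left h
    · exact le_max_right _ _
  | succ e ih =>
    have := hf e.le_succ
    rw [budget]
    split_ifs with h
    · exact le_max_of_le_left h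
    · exact ih.trans (max_le_max this le_rfl)

/-- The growth condition is used twice: first to push f above b, then to multiply that value by n +
1, which leaves room for n + 1 on top of b. -/
theorem exists_budget_add_le {f : ℕ → ℕ}
    (hM : ∀ N : ℕ, ∃ M : ℕ, (N + M + 1) * (f N + 1) ≤ f (N + M)) (b e : ℕ) :
    ∃ n, e ≤ n ∧ b + n + 1 ≤ f n := by
  obtain ⟨M, hM₁⟩ := hM (max b e)
  obtain ⟨M', hM₂⟩ := hM (max b e + M)
  refine ⟨max b e + M + M', by omega, ?_⟩
  have h₁ : max b e + M + 1 ≤ f (max b e + M) := 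
    (Nat.le_mul_of_pos_right _ (Nat.succ_pos _)).trans hM₁
  have h₂ : b + 1 ≤ f (max b e + M) := by omega
  have h₃ : max b e + M + M' + 1 ≤ (max b e + M + M' + 1) * (f (max b e + M) + 1 - b) :=
    Nat.le_mul_of_pos_right _ (by omega)
  have h₄ : b ≤ (max b e + M + M' + 1) * b := Nat.le_mul_of_pos_left _ (Nat.succ_pos _)
  calc b + (max b e + M + M') + 1 = (max b e + M + M' + 1) + b := by ring
    _ ≤ _ := add_le_add h₃ h₄
    _ = (max b e + M + M' + 1) * (f (max b e + M) + 1) := by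
      rw [← mul_add, Nat.sub_add_cancel (by omega)]
    _ ≤ _ := hM₂

theorem exists_placement_eq {f : ℕ → ℕ}
    (hM : ∀ N : ℕ, ∃ M : ℕ, (N + M + 1) * (f N + 1) ≤ f (N + M)) (k : ℕ) :
    ∃ e, placement f e = k + 1 := by
  -- If no room ever appeared after e, the budget would stay frozen while f outgrows it.
  have key : ∀ e, ∃ e', budget f e' = budget f e ∧ (budget f e').2 + e' + 1 ≤ f e' := by
    intro e
    by_contra! H
    have const : ∀ d, budget f (e + d) = budget f e := by
      intro d
      induction d with
      | zero => rfl
      | succ d ih => rw [← add_assoc, budget, if_neg (not_le.2 (H _ ih)), ih]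
    obtain ⟨n, hn, hn'⟩ := exists_budget_add_le hM (budget f e).2 e
    obtain ⟨d, rfl⟩ := Nat.exists_eq_add_of_le hn
    exact (H _ (const d)).not_ge (by rwa [const d])
  have fst : ∃ e, (budget f e).1 = k := by
    induction k with
    | zero => exact ⟨0, rfl⟩
    | succ k ih =>
      obtain ⟨e, rfl⟩ := ih
      obtain ⟨e', h₁, h₂⟩ := key e
      exact ⟨e' + 1, by rw [budget, if_pos h₂, h₁]⟩
  obtain ⟨e, rfl⟩ := fst
  obtain ⟨e', h₁, h₂⟩ := key e
  exact ⟨e', by rw [placement, if_pos h₂, h₁]⟩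

theorem computable_placement {f : ℕ → ℕ} (hf : Computable f) : Computable (placement f) := by
  have hle : PrimrecPred fun q : (ℕ × ℕ) × (ℕ × ℕ) => q.1.2 + q.2.1 + 1 ≤ q.2.2 :=
    Primrec.nat_le.comp (Primrec.succ.comp (Primrec.nat_add.comp
      (Primrec.snd.comp Primrec.fst) (Primrec.fst.comp Primrec.snd)))
      (Primrec.snd.comp Primrec.snd)
  have step : Computable fun q : (ℕ × ℕ) × (ℕ × ℕ) =>
      if q.1.2 + q.2.1 + 1 ≤ q.2.2 then (q.1.1 + 1, q.1.2 + q.2.1 + 1) else q.1 :=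
    Primrec.to_comp (Primrec.ite hle ((Primrec.succ.comp (Primrec.fst.comp Primrec.fst)).pair
      (Primrec.succ.comp (Primrec.nat_add.comp
        (Primrec.snd.comp Primrec.fst) (Primrec.fst.comp Primrec.snd)))) Primrec.fst)
  have last : Computable fun q : (ℕ × ℕ) × (ℕ × ℕ) =>
      if q.1.2 + q.2.1 + 1 ≤ q.2.2 then q.1.1 + 1 else 0 :=
    Primrec.to_comp (Primrec.ite hle (Primrec.succ.comp (Primrec.fst.comp Primrec.fst))
      (Primrec.const 0))
  have arg : Computable fun q : ℕ × (ℕ × ℕ) => (q.2, q.1, f q.1) :=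
    Computable.snd.pair (Computable.fst.pair (hf.comp Computable.fst))
  have hb : Computable (budget f) := computable_of_succ (step.comp arg) fun _ => rfl
  exact (last.comp (hb.pair (Computable.id.pair hf))).of_eq fun e => rfl

/-! ### The priority construction and its computability. -/

/-- The requirement that the action `p = (stage, witness)` was taken for. -/
abbrev owner (p : ℕ × ℕ) : ℕ := p.2.unpair.1

/-- An action injures all requirements of lower priority and of the opposite kind. -/
def Injures (p : ℕ × ℕ) (r : ℕ) : Prop :=
  owner p < r ∧ owner p % 2 ≠ r % 2

instance : DecidableRel Injures := fun _ _ => inferInstanceAs (Decidable (_ ∧ _))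

/-- The first stage at which `r` has no injury in the list `L` of actions ahead of it. -/
def restart (L : List (ℕ × ℕ)) (r : ℕ) : ℕ :=
  L.foldr (fun p m => if Injures p r then max (p.1 + 1) m else m) 0

/-- The current witness of `r` after the actions `L`. -/
def witness (L : List (ℕ × ℕ)) (r : ℕ) : ℕ :=
  Nat.pair r (restart L r)

/-- The first `n` values of the approximation, after the actions `L`, to the set of all witnesses
used by requirements of odd index. -/
def approx (L : List (ℕ × ℕ)) (n : ℕ) : List ℕ :=
  (List.range n).map fun m => if m.unpair.1 % 2 = 1 ∧ ∃ p ∈ L, p.2 = m then 1 else 0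

/-- The requirement `s.unpair.1` acts at stage `s`, after the actions `L`. The requirement
`2 * e + 1` makes `φ e` differ from the set of odd witnesses, and `2 * i` makes the functional with
index `c - 1`, if `c ≠ 0`, fail to compute the set of even witnesses from that of odd ones. -/
def Acts (c s : ℕ) (L : List (ℕ × ℕ)) : Prop :=
  (s.unpair.1 % 2 = 1 ∧ (∀ p ∈ L, owner p ≠ s.unpair.1) ∧
    Code.evaln s (ofNat Code (s.unpair.1 / 2)) (witness L s.unpair.1) = some 0) ∨
  (s.unpair.1 % 2 = 0 ∧ c ≠ 0 ∧ (∀ p ∈ L, p.2 ≠ witness L s.unpair.1) ∧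
    Code.evaln s (ofNat Code (c - 1))
      (encode (approx L s.unpair.2.unpair.1, witness L s.unpair.1)) = some 0)

instance (c s : ℕ) (L : List (ℕ × ℕ)) : Decidable (Acts c s L) :=
  inferInstanceAs (Decidable (_ ∨ _))

/-- The actions taken before stage `s`, the latest first. -/
def stage (c : ℕ → ℕ) : ℕ → List (ℕ × ℕ)
  | 0 => []
  | s + 1 => if Acts (c (s.unpair.1 / 2)) s (stage c s)
      then (s, witness (stage c s) s.unpair.1) :: stage c s else stage c s

theorem primrec_owner : Primrec owner :=
  Primrec.fst.comp (Primrec.unpair.comp Primrec.snd)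

theorem primrecRel_injures : PrimrecRel Injures := by
  have h : Primrec fun q : (ℕ × ℕ) × ℕ => owner q.1 := primrec_owner.comp Primrec.fst
  exact PrimrecPred.and (Primrec.nat_lt.comp h Primrec.snd)
    (Primrec.eq.comp (Primrec.nat_mod.comp h (Primrec.const 2))
      (Primrec.nat_mod.comp Primrec.snd (Primrec.const 2))).not

theorem primrec_restart : Primrec₂ restart := by
  refine Primrec.list_foldr (f := fun q : List (ℕ × ℕ) × ℕ => q.1) (g := fun _ => 0)
    (h := fun q a => if Injures a.1 q.2 then max (a.1.1 + 1) a.2 else a.2)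
    Primrec.fst (Primrec.const 0) ?_
  refine Primrec.ite ?_ ?_ (Primrec.snd.comp Primrec.snd)
  · exact primrecRel_injures.comp (Primrec.fst.comp Primrec.snd) (Primrec.snd.comp Primrec.fst)
  · exact Primrec.nat_max.comp
      (Primrec.succ.comp (Primrec.fst.comp (Primrec.fst.comp Primrec.snd)))
      (Primrec.snd.comp Primrec.snd)

theorem primrec_witness : Primrec₂ witness :=
  Primrec₂.natPair.comp Primrec.snd primrec_restart

theorem primrecRel_exists_snd_eq :
    PrimrecRel fun (L : List (ℕ × ℕ)) (x : ℕ) => ∃ p ∈ L, p.2 = x :=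
  PrimrecRel.exists_mem_list (R := fun (p : ℕ × ℕ) x => p.2 = x)
    (Primrec.eq.comp (Primrec.snd.comp Primrec.fst) Primrec.snd)

theorem primrec_approx : Primrec₂ approx := by
  refine Primrec.list_map (Primrec.list_range.comp Primrec.snd)
    (Primrec.ite ?_ (Primrec.const 1) (Primrec.const 0))
  refine PrimrecPred.and (Primrec.eq.comp (Primrec.nat_mod.comp
    (Primrec.fst.comp (Primrec.unpair.comp Primrec.snd)) (Primrec.const 2)) (Primrec.const 1)) ?_
  exact primrecRel_exists_snd_eq.comp (Primrec.fst.comp Primrec.fst) Primrec.snd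

theorem primrecPred_acts :
    PrimrecPred fun q : (ℕ × ℕ) × List (ℕ × ℕ) => Acts q.1.1 q.1.2 q.2 := by
  have hc : Primrec fun q : (ℕ × ℕ) × List (ℕ × ℕ) => q.1.1 := Primrec.fst.comp Primrec.fst
  have hs : Primrec fun q : (ℕ × ℕ) × List (ℕ × ℕ) => q.1.2 := Primrec.snd.comp Primrec.fst
  have hr : Primrec fun q : (ℕ × ℕ) × List (ℕ × ℕ) => q.1.2.unpair.1 :=
    Primrec.fst.comp (Primrec.unpair.comp hs)
  have hn : Primrec fun q : (ℕ × ℕ) × List (ℕ × ℕ) => q.1.2.unpair.2.unpair.1 :=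
    Primrec.fst.comp (Primrec.unpair.comp (Primrec.snd.comp (Primrec.unpair.comp hs)))
  have hL : Primrec fun q : (ℕ × ℕ) × List (ℕ × ℕ) => q.2 := Primrec.snd
  have hw : Primrec fun q : (ℕ × ℕ) × List (ℕ × ℕ) => witness q.2 q.1.2.unpair.1 :=
    primrec_witness.comp hL hr
  have hev : ∀ {d x : (ℕ × ℕ) × List (ℕ × ℕ) → ℕ}, Primrec d → Primrec x →
      PrimrecPred fun q => Code.evaln q.1.2 (ofNat Code (d q)) (x q) = some 0 := by
    intro d x hd hx
    exact Primrec.eq.comp (Code.primrec_evaln.comp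
      ((hs.pair ((Primrec.ofNat Code).comp hd)).pair hx)) (Primrec.const (some 0))
  refine PrimrecPred.or (PrimrecPred.and ?_ (PrimrecPred.and ?_ (hev ?_ hw)))
    (PrimrecPred.and ?_ (PrimrecPred.and ?_ (PrimrecPred.and ?_ (hev ?_ ?_))))
  · exact Primrec.eq.comp (Primrec.nat_mod.comp hr (Primrec.const 2)) (Primrec.const 1)
  · exact (PrimrecRel.forall_mem_list (R := fun (p : ℕ × ℕ) r => owner p ≠ r)
      (Primrec.eq.comp (primrec_owner.comp Primrec.fst) Primrec.snd).not).comp hL hr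
  · exact Primrec.nat_div.comp hr (Primrec.const 2)
  · exact Primrec.eq.comp (Primrec.nat_mod.comp hr (Primrec.const 2)) (Primrec.const 0)
  · exact (Primrec.eq.comp hc (Primrec.const 0)).not
  · exact (PrimrecRel.forall_mem_list (R := fun (p : ℕ × ℕ) x => p.2 ≠ x)
      (Primrec.eq.comp (Primrec.snd.comp Primrec.fst) Primrec.snd).not).comp hL hw
  · exact Primrec.nat_sub.comp hc (Primrec.const 1)
  · exact Primrec.encode.comp ((primrec_approx.comp hL hn).pair hw)

theorem computable_stage {c : ℕ → ℕ} (hc : Computable c) : Computable (stage c) := by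
  have step : Computable fun q : (ℕ × ℕ) × List (ℕ × ℕ) =>
      if Acts q.1.1 q.1.2 q.2 then (q.1.2, witness q.2 q.1.2.unpair.1) :: q.2 else q.2 := by
    have hs : Primrec fun q : (ℕ × ℕ) × List (ℕ × ℕ) => q.1.2 := Primrec.snd.comp Primrec.fst
    exact Primrec.to_comp (Primrec.ite primrecPred_acts (Primrec.list_cons.comp
      (hs.pair (primrec_witness.comp Primrec.snd (Primrec.fst.comp (Primrec.unpair.comp hs))))
      Primrec.snd) Primrec.snd)
  have arg : Computable fun q : ℕ × List (ℕ × ℕ) => ((c (q.1.unpair.1 / 2), q.1), q.2) :=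
    ((hc.comp (Primrec.nat_div.to_comp.comp (Computable.fst.comp (Computable.unpair.comp
      Computable.fst)) (Computable.const 2))).pair Computable.fst).pair Computable.snd
  exact computable_of_succ (step.comp arg) fun _ => rfl

/-! ### Counting actions, injuries and witnesses. -/

theorem restart_eq_zero_or (L : List (ℕ × ℕ)) (r : ℕ) :
    restart L r = 0 ∨ ∃ p ∈ L, Injures p r ∧ restart L r = p.1 + 1 := by
  induction L with
  | nil => exact .inl rfl
  | cons p L ih =>
    simp only [restart, List.foldr_cons] at ih ⊢
    split_ifs with h
    · rcases max_choice (p.1 + 1) (restart L r) with h' | h' <;> simp only [restart] at h' <;>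
        rw [h'] <;> simp <;> grind
    · grind

theorem lt_restart {L : List (ℕ × ℕ)} {r : ℕ} {p : ℕ × ℕ} (hp : p ∈ L) (h : Injures p r) :
    p.1 < restart L r := by
  induction L with
  | nil => cases hp
  | cons q L ih =>
    simp only [restart, List.foldr_cons] at ih ⊢
    rcases List.mem_cons.1 hp with rfl | hp
    · rw [if_pos h]
      omega
    · have := ih hp
      split_ifs <;> omega

theorem restart_le_restart {L L' : List (ℕ × ℕ)} {r : ℕ}
    (h : ∀ p ∈ L, Injures p r → p ∈ L') : restart L r ≤ restart L' r := by
  rcases restart_eq_zero_or L r with h₀ | ⟨p, hp, hr, h₀⟩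
  · omega
  · rw [h₀]
    exact lt_restart (h p hp hr) hr

/-- All actions ever taken. -/
def actions (c : ℕ → ℕ) : Set (ℕ × ℕ) :=
  {p | Acts (c (p.1.unpair.1 / 2)) p.1 (stage c p.1) ∧
    p.2 = witness (stage c p.1) p.1.unpair.1}

/-- All witnesses that the requirement `r` ever has. -/
def candidates (c : ℕ → ℕ) (r : ℕ) : Set ℕ :=
  {x | ∃ s, x = witness (stage c s) r}

/-- The set of all witnesses used by requirements `r` with `r % 2 = i`. -/
def enumerated (c : ℕ → ℕ) (i : ℕ) : Set ℕ :=
  {x | x.unpair.1 % 2 = i ∧ ∃ p ∈ actions c, p.2 = x}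

variable {c : ℕ → ℕ}

/-- Actions carry their stage, so the dynamic lists are initial parts of one static set. -/
theorem mem_stage {s : ℕ} {p : ℕ × ℕ} : p ∈ stage c s ↔ p.1 < s ∧ p ∈ actions c := by
  induction s with
  | zero => simp [stage]
  | succ s ih =>
    have h : p = (s, witness (stage c s) s.unpair.1) ∧
        Acts (c (s.unpair.1 / 2)) s (stage c s) ↔ p.1 = s ∧ p ∈ actions c := by
      obtain ⟨t, x⟩ := p
      constructor
      · rintro ⟨h, h'⟩
        obtain ⟨rfl, rfl⟩ := Prod.mk.inj h
        exact ⟨rfl, h', rfl⟩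
      · rintro ⟨rfl, h', h⟩
        exact ⟨Prod.ext rfl h, h'⟩
    rw [stage, Nat.lt_succ_iff_lt_or_eq, or_and_right, ← ih, ← h]
    split_ifs with hs
    · simp [hs, or_comm]
    · simp [hs]

theorem owner_eq {p : ℕ × ℕ} (hp : p ∈ actions c) : owner p = p.1.unpair.1 := by
  rw [owner, hp.2, witness, Nat.unpair_pair]

theorem snd_mem_candidates {p : ℕ × ℕ} (hp : p ∈ actions c) : p.2 ∈ candidates c (owner p) :=
  ⟨p.1, by rw [owner_eq hp, hp.2]⟩

theorem snd_eq_of_owner_eq {p : ℕ × ℕ} {r : ℕ} (hp : p ∈ actions c) (h : owner p = r) :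
    p.2 = witness (stage c p.1) r := by
  rw [hp.2, ← h, owner_eq hp]

theorem eq_of_fst_eq {p q : ℕ × ℕ} (hp : p ∈ actions c) (hq : q ∈ actions c) (h : p.1 = q.1) :
    p = q :=
  Prod.ext h (by rw [hp.2, hq.2, h])

theorem acts_of_odd {p : ℕ × ℕ} (hp : p ∈ actions c) (h : owner p % 2 = 1) :
    (∀ q ∈ stage c p.1, owner q ≠ owner p) ∧
      Code.evaln p.1 (ofNat Code (owner p / 2)) p.2 = some 0 := by
  have := hp.1
  rw [Acts, ← hp.2, ← owner_eq hp] at this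
  grind

theorem acts_of_even {p : ℕ × ℕ} (hp : p ∈ actions c) (h : owner p % 2 = 0) :
    c (owner p / 2) ≠ 0 ∧ (∀ q ∈ stage c p.1, q.2 ≠ p.2) ∧
      Code.evaln p.1 (ofNat Code (c (owner p / 2) - 1))
        (encode (approx (stage c p.1) p.1.unpair.2.unpair.1, p.2)) = some 0 := by
  have := hp.1
  rw [Acts, ← hp.2, ← owner_eq hp] at this
  grind

/-- An odd requirement acts only if it has not acted before; one action suffices, since nothing
leaves A. -/
theorem eq_of_owner_odd {p q : ℕ × ℕ} (hp : p ∈ actions c) (hq : q ∈ actions c)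
    (h : owner p % 2 = 1) (hpq : owner p = owner q) : p = q := by
  rcases lt_trichotomy p.1 q.1 with hlt | heq | hlt
  · exact absurd hpq ((acts_of_odd hq (hpq ▸ h)).1 p (mem_stage.2 ⟨hlt, hp⟩))
  · exact eq_of_fst_eq hp hq heq
  · exact absurd hpq.symm ((acts_of_odd hp h).1 q (mem_stage.2 ⟨hlt, hq⟩))

theorem eq_of_snd_eq {p q : ℕ × ℕ} (hp : p ∈ actions c) (hq : q ∈ actions c)
    (hpq : p.2 = q.2) : p = q := by
  have howner : owner p = owner q := by rw [owner, hpq]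
  rcases Nat.mod_two_eq_zero_or_one (owner p) with h | h
  · rcases lt_trichotomy p.1 q.1 with hlt | heq | hlt
    · exact absurd hpq ((acts_of_even hq (howner ▸ h)).2.1 p (mem_stage.2 ⟨hlt, hp⟩))
    · exact eq_of_fst_eq hp hq heq
    · exact absurd hpq.symm ((acts_of_even hp h).2.1 q (mem_stage.2 ⟨hlt, hq⟩))
  · exact eq_of_owner_odd hp hq h howner

/-- A restart value is 0 or one past the stage of an injury, so each further witness is charged to
an injury. -/
theorem encard_candidates_le (c : ℕ → ℕ) (r : ℕ) :
    (candidates c r).encard ≤ 1 + {p ∈ actions c | Injures p r}.encard := by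
  have hsub : candidates c r ⊆
      {Nat.pair r 0} ∪ (fun p => Nat.pair r (p.1 + 1)) '' {p ∈ actions c | Injures p r} := by
    rintro _ ⟨s, rfl⟩
    rcases restart_eq_zero_or (stage c s) r with h | ⟨p, hp, hr, h⟩
    · left
      simp [witness, h]
    · right
      exact ⟨p, ⟨(mem_stage.1 hp).2, hr⟩, by simp [witness, h]⟩
  calc _ ≤ _ := Set.encard_le_encard hsub
    _ ≤ _ := Set.encard_union_le _ _
    _ ≤ _ := by
      rw [Set.encard_singleton]
      exact add_le_add_right (Set.encard_image_le _ _) _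

theorem encard_owner_le (c : ℕ → ℕ) (r : ℕ) :
    {p ∈ actions c | owner p = r}.encard ≤ (candidates c r).encard :=
  Set.encard_le_encard_of_injOn (f := Prod.snd) (fun _ hp => hp.2 ▸ snd_mem_candidates hp.1)
    fun _ hp _ hq h => eq_of_snd_eq hp.1 hq.1 h

/-- Only the i odd requirements `2 * j + 1` with j < i can injure, each once. -/
theorem encard_injures_even_le (c : ℕ → ℕ) (i : ℕ) :
    {p ∈ actions c | Injures p (2 * i)}.encard ≤ i := by
  have hsub : {p ∈ actions c | Injures p (2 * i)} ⊆
      ⋃ j ∈ Finset.range i, {p ∈ actions c | owner p = 2 * j + 1} := by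
    rintro p ⟨hp, hlt, hne⟩
    refine Set.mem_biUnion (x := owner p / 2) (Finset.mem_coe.2 (Finset.mem_range.2 ?_)) ⟨hp, ?_⟩
    all_goals omega
  refine ((Set.encard_le_encard hsub).trans (Finset.set_encard_biUnion_le _ _)).trans ?_
  refine (Finset.sum_le_sum fun j _ => Set.encard_le_one_iff.2 fun p q hp hq =>
    eq_of_owner_odd hp.1 hq.1 (by rw [hp.2]; omega) (hp.2.trans hq.2.symm)).trans ?_
  simp

/-- Each placed `2 * i` has at most i + 1 witnesses and uses each at most once; unplaced ones never
act. -/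
theorem encard_injures_odd_le (c : ℕ → ℕ) (e : ℕ) :
    {p ∈ actions c | Injures p (2 * e + 1)}.encard ≤
      ((∑ i ∈ Finset.range (e + 1), if c i = 0 then 0 else i + 1 : ℕ) : ℕ∞) := by
  have hsub : {p ∈ actions c | Injures p (2 * e + 1)} ⊆
      ⋃ i ∈ Finset.range (e + 1), {p ∈ actions c | owner p = 2 * i} := by
    rintro p ⟨hp, hlt, hne⟩
    refine Set.mem_biUnion (x := owner p / 2) (Finset.mem_coe.2 (Finset.mem_range.2 ?_)) ⟨hp, ?_⟩
    all_goals omega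
  refine ((Set.encard_le_encard hsub).trans (Finset.set_encard_biUnion_le _ _)).trans ?_
  rw [Nat.cast_sum]
  refine Finset.sum_le_sum fun i _ => ?_
  split_ifs with hc
  · rw [Nat.cast_zero, nonpos_iff_eq_zero, Set.encard_eq_zero, Set.eq_empty_iff_forall_notMem]
    rintro p ⟨hp, hi⟩
    refine (acts_of_even hp (by omega)).1 ?_
    rwa [hi, Nat.mul_div_cancel_left _ two_pos]
  · refine ((encard_owner_le c _).trans (encard_candidates_le c _)).trans ?_
    rw [add_comm i 1, Nat.cast_add, Nat.cast_one]
    exact add_le_add_right (encard_injures_even_le c i) _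

theorem finite_injures (c : ℕ → ℕ) (r : ℕ) : {p ∈ actions c | Injures p r}.Finite := by
  obtain ⟨i, rfl | rfl⟩ := Nat.even_or_odd' r
  · exact Set.finite_of_encard_le_coe (encard_injures_even_le c i)
  · exact Set.finite_of_encard_le_coe (encard_injures_odd_le c i)

/-- Injuries are finite in number, so witnesses settle. That the final restart is also the maximum
later rules out injuries after an action with the final witness. -/
theorem eventually_restart_eq (c : ℕ → ℕ) (r : ℕ) :
    ∃ s₀, ∀ s, restart (stage c s) r ≤ restart (stage c s₀) r ∧
      (s₀ ≤ s → witness (stage c s) r = witness (stage c s₀) r) := by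
  obtain ⟨b, hb⟩ := ((finite_injures c r).image Prod.fst).bddAbove
  have key : ∀ s, restart (stage c s) r ≤ restart (stage c (b + 1)) r := fun s =>
    restart_le_restart fun p hp hr => by
      have := hb ⟨p, ⟨(mem_stage.1 hp).2, hr⟩, rfl⟩
      exact mem_stage.2 ⟨by omega, (mem_stage.1 hp).2⟩
  refine ⟨b + 1, fun s => ⟨key s, fun hs => congrArg _ ((key s).antisymm ?_)⟩⟩
  exact restart_le_restart fun p hp _ =>
    mem_stage.2 ⟨(mem_stage.1 hp).1.trans_le hs, (mem_stage.1 hp).2⟩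

/-- The hypothesis says that nothing below n enters the odd set at stage s or later. -/
theorem approx_eq {s n : ℕ}
    (h : ∀ p ∈ actions c, owner p % 2 = 1 → p.2 < n → p.1 < s) :
    approx (stage c s) n = (List.range n).map (chi (enumerated c 1)) := by
  refine List.map_congr_left fun m hm => ?_
  have hiff : (m.unpair.1 % 2 = 1 ∧ ∃ p ∈ stage c s, p.2 = m) ↔ m ∈ enumerated c 1 := by
    refine and_congr_right fun hm' => exists_congr fun p => and_congr_left ?_
    rintro rfl
    exact ⟨fun hp => (mem_stage.1 hp).2,
      fun hp => mem_stage.2 ⟨h p hp hm' (List.mem_range.1 hm), hp⟩⟩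
  classical
  rw [chi, Set.indicator_apply, Pi.one_apply]
  simp only [hiff]

/-! ### Recursive enumerability of the sets and of the witness sets. -/

theorem rePred_exists_mem_list {u : ℕ → List (ℕ × ℕ)} (hu : Computable u) (i : ℕ) :
    REPred fun x : ℕ => ∃ s, x.unpair.1 % 2 = i ∧ ∃ p ∈ u s, p.2 = x := by
  have h : PrimrecPred fun q : List (ℕ × ℕ) × ℕ =>
      q.2.unpair.1 % 2 = i ∧ ∃ p ∈ q.1, p.2 = q.2 :=
    PrimrecPred.and (Primrec.eq.comp (Primrec.nat_mod.comp
      (Primrec.fst.comp (Primrec.unpair.comp Primrec.snd)) (Primrec.const 2)) (Primrec.const i))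
      primrecRel_exists_snd_eq
  have arg : Computable fun q : ℕ × ℕ => (u q.2, q.1) :=
    (hu.comp Computable.snd).pair Computable.fst
  exact rePred_exists (Computable.to₂ (h.decide.to_comp.comp arg))

theorem rePred_enumerated (hc : Computable c) (i : ℕ) :
    REPred fun x => x ∈ enumerated c i := by
  refine (rePred_exists_mem_list (computable_stage hc) i).of_eq fun x => ⟨?_, ?_⟩
  · rintro ⟨s, hx, p, hp, rfl⟩
    exact ⟨hx, p, (mem_stage.1 hp).2, rfl⟩
  · rintro ⟨hx, p, hp, rfl⟩
    exact ⟨p.1 + 1, hx, p, mem_stage.2 ⟨p.1.lt_succ_self, hp⟩, rfl⟩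

theorem exists_computable_W_eq_candidates (hc : Computable c) :
    ∃ g : ℕ → ℕ, Computable g ∧ ∀ e, W (g e) = candidates c (2 * e + 1) := by
  have h : Computable₂ fun (q : ℕ × ℕ) (s : ℕ) =>
      decide (q.2 = witness (stage c s) (2 * q.1 + 1)) := by
    refine (PrimrecRel.decide Primrec.eq).to_comp.comp (Computable.snd.comp Computable.fst)
      (primrec_witness.to_comp.comp ((computable_stage hc).comp Computable.snd) ?_)
    exact (Primrec.succ.comp (Primrec.nat_mul.comp (Primrec.const 2)
      (Primrec.fst.comp Primrec.fst))).to_comp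
  have hf : Partrec₂ fun e x : ℕ => (Part.assert (∃ s, x = witness (stage c s) (2 * e + 1))
      fun _ => Part.some ()).map fun _ => (0 : ℕ) :=
    Partrec.map (rePred_exists h) (Computable.const 0).to₂
  obtain ⟨g, hg, hgf⟩ := exists_computable_phi hf
  refine ⟨g, hg, fun e => Set.ext fun x => ?_⟩
  simp [W, hgf, candidates, Part.assert]

/-! ### Satisfaction of the requirements. -/

/-- A stage codes a requirement, an oracle length and padding; the padding makes every combination
recur arbitrarily late. -/
theorem exists_stage_unpair_eq (r n b : ℕ) :
    ∃ s, b ≤ s ∧ s.unpair.1 = r ∧ s.unpair.2.unpair.1 = n :=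
  ⟨Nat.pair r (Nat.pair n b), (Nat.right_le_pair n b).trans (Nat.right_le_pair r _), by simp,
    by simp⟩

/-- The positive requirements are met. -/
theorem exists_candidate_ne (c : ℕ → ℕ) (e : ℕ) :
    ∃ z ∈ candidates c (2 * e + 1), φ e z ≠ Part.some (chi (enumerated c 1) z) := by
  by_cases hact : ∃ p ∈ actions c, owner p = 2 * e + 1
  · obtain ⟨p, hp, hpe⟩ := hact
    refine ⟨p.2, hpe ▸ snd_mem_candidates hp, ?_⟩
    have hodd : owner p % 2 = 1 := by omega
    have h₀ := (acts_of_odd hp hodd).2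
    rw [hpe, show (2 * e + 1) / 2 = e by omega] at h₀
    have h₁ : φ e p.2 = Part.some 0 := Part.eq_some_iff.2 (Code.evaln_sound h₀)
    have h₂ : p.2 ∈ enumerated c 1 := ⟨hodd, p, hp, rfl⟩
    simp [h₁, chi, h₂]
  -- The final witness z stays outside A, so agreement would mean φ_e(z) = 0, which triggers an
  -- action at a late stage.
  · push Not at hact
    obtain ⟨s₀, hs₀⟩ := eventually_restart_eq c (2 * e + 1)
    refine ⟨_, ⟨s₀, rfl⟩, fun heq => ?_⟩
    set z := witness (stage c s₀) (2 * e + 1) with hz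
    have hzA : z ∉ enumerated c 1 := by
      rintro ⟨-, p, hp, hpz⟩
      exact hact p hp (by rw [owner, hpz, hz, witness, Nat.unpair_pair])
    have h₀ : 0 ∈ (ofNat Code e).eval z := by
      rw [chi, Set.indicator_of_notMem hzA] at heq
      exact Part.eq_some_iff.1 heq
    obtain ⟨k, hk⟩ := Code.evaln_complete.1 h₀
    obtain ⟨s, hs, hsr, -⟩ := exists_stage_unpair_eq (2 * e + 1) 0 (max s₀ k)
    have hw : witness (stage c s) s.unpair.1 = z := by
      rw [hsr]
      exact (hs₀ s).2 ((le_max_left _ _).trans hs)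
    have hacts : Acts (c (s.unpair.1 / 2)) s (stage c s) := by
      refine .inl ⟨by omega, fun p hp => hsr ▸ hact p (mem_stage.1 hp).2, ?_⟩
      rw [hw, hsr, show (2 * e + 1) / 2 = e by omega]
      exact Code.evaln_mono ((le_max_right _ _).trans hs) hk
    exact hact (s, z) ⟨hacts, hw.symm⟩ (by rw [owner, hz, witness, Nat.unpair_pair])

/-- The negative requirements are met. -/
theorem not_turingLE_enumerated (hc : ∀ k, ∃ i, c i = k + 1) :
    ¬ TuringLE (enumerated c 0) (enumerated c 1) := by
  intro hle
  obtain ⟨F, hF, hF₁, hF₂⟩ := exists_partrec_functional hle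
  have hF' : Partrec fun m : ℕ => (Part.ofOption (decode (α := List ℕ × ℕ) m)).bind
      fun q => F q.1 q.2 :=
    Partrec.bind (Computable.ofOption Computable.decode) (hF.comp
      (Computable.fst.comp Computable.snd) (Computable.snd.comp Computable.snd))
  obtain ⟨d, hd⟩ := Code.exists_code.1 (Partrec.nat_iff.1 hF')
  have hdF : ∀ σ x, d.eval (encode (σ, x)) = F σ x := fun σ x => by
    have h : (Part.ofOption (decode (α := List ℕ × ℕ) (encode (σ, x)))).bind
        (fun q => F q.1 q.2) = F σ x := by
      rw [encodek]
      exact Part.bind_some _ _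
    exact (congrFun hd _).trans h
  obtain ⟨i, hi⟩ := hc (encode d)
  have hdi : ofNat Code (c i - 1) = d := by rw [hi, Nat.add_sub_cancel, ofNat_encode]
  obtain ⟨s₀, hs₀⟩ := eventually_restart_eq c (2 * i)
  set x := witness (stage c s₀) (2 * i) with hx
  have hx₁ : x.unpair.1 = 2 * i := by rw [hx, witness, Nat.unpair_pair]
  have hx₂ : x.unpair.2 = restart (stage c s₀) (2 * i) := by rw [hx, witness, Nat.unpair_pair]
  -- If x enters B, the computation giving 0 must be shown to survive; if not, a true computation
  -- giving 0 would eventually put x into B.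
  by_cases hxB : x ∈ enumerated c 0
  · obtain ⟨-, p, hp, hpx⟩ := hxB
    have howner : owner p = 2 * i := by rw [owner, hpx, hx₁]
    have h₀ := (acts_of_even hp (by omega)).2.2
    set n := p.1.unpair.2.unpair.1 with hn
    -- The oracle length is coded in the stage, so it cannot exceed the stage.
    have hnp : n ≤ p.1 :=
      (Nat.unpair_left_le _).trans (Nat.unpair_right_le _)
    have hrestart : restart (stage c p.1) (2 * i) = restart (stage c s₀) (2 * i) := by
      rw [← hx₂, ← hpx, snd_eq_of_owner_eq hp howner, witness, Nat.unpair_pair]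
    rw [howner, Nat.mul_div_cancel_left _ two_pos, hdi, hpx, approx_eq] at h₀
    · have h₁ : 0 ∈ F ((List.range n).map (chi (enumerated c 1))) x :=
        hdF _ _ ▸ Code.evaln_sound h₀
      have h₂ := Part.mem_some_iff.1 (hF₁ _ _ _ h₁)
      have hxB : x ∈ enumerated c 0 := ⟨by omega, p, hp, hpx⟩
      rw [chi, Set.indicator_of_mem hxB] at h₂
      exact zero_ne_one h₂
    · intro q hq hodd hqn
      by_contra! hpq
      have hlt : p.1 < q.1 := hpq.lt_of_ne fun h => by
        rw [eq_of_fst_eq hp hq h] at howner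
        omega
      rcases lt_or_gt_of_ne (show owner q ≠ 2 * i by omega) with h | h
      -- A later action of higher priority would push the restart past its final value.
      · have h₁ : q.1 < restart (stage c (q.1 + 1)) (2 * i) :=
          lt_restart (mem_stage.2 ⟨q.1.lt_succ_self, hq⟩) ⟨h, by omega⟩
        have h₂ := (hs₀ (q.1 + 1)).1
        rcases restart_eq_zero_or (stage c p.1) (2 * i) with h₃ | ⟨p', hp', -, h₃⟩
        · omega
        · have := (mem_stage.1 hp').1
          omega
      -- A lower-priority owner was injured by p, so its witness exceeds `p.1`, hence n.
      · have h₁ : p.1 < restart (stage c q.1) (owner q) :=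
          lt_restart (mem_stage.2 ⟨hlt, hp⟩) ⟨by omega, by omega⟩
        have h₂ : restart (stage c q.1) (owner q) ≤ q.2 := by
          rw [snd_eq_of_owner_eq hq rfl]
          exact Nat.right_le_pair _ _
        omega
  · have h₀ : 0 ∈ (Part.some (chi (enumerated c 0) x) : Part ℕ) := by
      rw [chi, Set.indicator_of_notMem hxB]
      exact Part.mem_some _
    obtain ⟨n, hn⟩ := (hF₂ _ _ h₀).exists
    rw [← hdF] at hn
    obtain ⟨k, hk⟩ := Code.evaln_complete.1 hn
    -- Distinct actions use distinct witnesses, so only finitely many concern numbers below n; after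
    -- stage b the oracle segment is correct.
    obtain ⟨b, hb⟩ : BddAbove (Prod.fst '' {p ∈ actions c | p.2 < n}) :=
      (Set.Finite.image _ (Set.Finite.of_finite_image (f := Prod.snd)
        ((Set.finite_Iio n).subset (by rintro _ ⟨p, hp, rfl⟩; exact hp.2))
        fun p hp q hq h => eq_of_snd_eq hp.1 hq.1 h)).bddAbove
    obtain ⟨s, hs, hsr, hsn⟩ := exists_stage_unpair_eq (2 * i) n (max s₀ (max k (b + 1)))
    have hw : witness (stage c s) s.unpair.1 = x := by
      rw [hsr]
      exact (hs₀ s).2 (by omega)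
    have hacts : Acts (c (s.unpair.1 / 2)) s (stage c s) := by
      refine .inr ⟨by omega, ?_, ?_, ?_⟩
      · rw [hsr, Nat.mul_div_cancel_left _ two_pos, hi]
        exact Nat.succ_ne_zero _
      · rw [hw]
        exact fun p hp hpx => hxB ⟨by omega, p, (mem_stage.1 hp).2, hpx⟩
      · rw [hw, hsr, hsn, Nat.mul_div_cancel_left _ two_pos, hdi, approx_eq]
        · exact Code.evaln_mono (by omega) hk
        · intro p hp _ hpn
          have := hb ⟨p, ⟨hp, hpn⟩, rfl⟩
          omega
    exact hxB ⟨by omega, (s, x), ⟨hacts, hw.symm⟩, rfl⟩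

/-! ### Assembling the theorem. -/

theorem isWWEU_enumerated (hc : Computable c) {f : ℕ → ℕ}
    (hf : ∀ e, 1 + ∑ i ∈ Finset.range (e + 1), (if c i = 0 then 0 else i + 1) ≤ f e) :
    IsWWEU f (enumerated c 1) := by
  obtain ⟨g, hg, hW⟩ := exists_computable_W_eq_candidates hc
  refine ⟨rePred_enumerated hc 1, g, hg, fun e => ⟨?_, ?_⟩⟩
  · rw [hW]
    calc _ ≤ _ := encard_candidates_le c _
      _ ≤ _ := add_le_add_right (encard_injures_odd_le c e) 1
      _ ≤ (f e : ℕ∞) := by exact_mod_cast hf e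
  · rw [hW]
    exact fun _ => exists_candidate_ne c e

theorem enumerated_turingLT_K (hc : Computable c) (hc' : ∀ k, ∃ i, c i = k + 1) :
    TuringLT (enumerated c 1) K :=
  ⟨turingLE_K (rePred_enumerated hc 1), fun h => not_turingLE_enumerated hc'
    (TuringReducible.trans (turingLE_K (rePred_enumerated hc 0)) h)⟩

theorem exists_isWWEU {f : ℕ → ℕ} (hf : Monotone f) (hf' : Computable f)
    (hM : ∀ N : ℕ, ∃ M : ℕ, (N + M + 1) * (f N + 1) ≤ f (N + M)) :
    ∃ A : Set ℕ, IsWWEU (fun n => max (f n) 1) A ∧ (1 ≤ f 0 → IsWWEU f A) ∧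
      TuringLT ∅ A ∧ TuringLT A K := by
  have hA : IsWWEU (fun n => max (f n) 1) (enumerated (placement f) 1) :=
    isWWEU_enumerated (computable_placement hf') fun e =>
      (sum_placement f (e + 1)).trans_le (budget_le hf e)
  refine ⟨_, hA, fun h₀ => ?_, hA.empty_turingLT,
    enumerated_turingLT_K (computable_placement hf') (exists_placement_eq hM)⟩
  rwa [funext fun n => max_eq_left (h₀.trans (hf n.zero_le))] at hA

end PostProblem

theorem mainTheorem7 :
    (∀ f : ℕ → ℕ, Monotone f → Computable f →
      (∀ N : ℕ, ∃ M : ℕ, (N + M + 1) * (f N + 1) ≤ f (N + M)) →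
      ∃ A : Set ℕ,
        PostProblem.IsWWEU (fun n => max (f n) 1) A ∧
        (1 ≤ f 0 → PostProblem.IsWWEU f A) ∧
        PostProblem.TuringLT ∅ A ∧ PostProblem.TuringLT A PostProblem.K) ∧
    (∃ A : Set ℕ,
      PostProblem.IsWWEU (fun n => max (n ^ 2) 1) A ∧
      PostProblem.TuringLT ∅ A ∧ PostProblem.TuringLT A PostProblem.K) := by
  refine ⟨fun f hf hf' hM => PostProblem.exists_isWWEU hf hf' hM, ?_⟩
  obtain ⟨A, h₁, -, h₂⟩ := PostProblem.exists_isWWEU (f := fun n => n ^ 2)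
    (fun a b h => Nat.pow_le_pow_left h 2)
    ((Primrec.nat_mul.comp Primrec.id Primrec.id).to_comp.of_eq fun n => (sq n).symm)
    -- With a = N + M = N² + N + 2, one has (a + 1)(N² + 1) = a² - aN - N - 1 ≤ a²; M = N² + 1 would
    -- fail at N = 0.
    fun N => ⟨N ^ 2 + 2, by nlinarith [Nat.zero_le (N ^ 2), Nat.zero_le N]⟩
  exact ⟨A, h₁, h₂⟩
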